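/- Let $A$ be a finite totally ordered alphabet. A column is a subset $\gamma\subseteq A$; write $\Gamma(A)$ for the set of columns. A letter $a$ acts on a column $\gamma$ by Schensted column insertion: if $\gamma$ has an entry $\ge a$, then $a\cdot\gamma$ is obtained by replacing the smallest such entry by $a$; otherwise $a\cdot\gamma=\gamma\cup\{a\}$. This extends to a left action of the free monoid $A^*$ on $\Gamma(A)$. The stylic monoid $\mathrm{Styl}(A)$ is the (finite) monoid of endofunctions of $\Gamma(A)$ so obtained, and $\mu:A^*\to\mathrm{Styl}(A)$ is the canonical homomorphism. The $N$-tableau $N(w)$ of a word $w$ is obtained by inserting its letters from left to right into the empty tableau: inserting $a$ into a row (a set of letters) adds $a$ to it, and, if the row has entries $>a$, the smallest of them also stays in the row and is inserted in the same way into the next row above. For $x=\mu(w)\in\mathrm{Styl}(A)$ let $\eta(x)$ be the first column of $N(w)$ (the set of the smallest entries of its rows); it depends only on $x$. Let $\theta$ be the anti-automorphism of $A^*$ that reverses the order of $A$; it acts on columns (as sets of letters) and induces an anti-automorphism, also written $\theta$, of $\mathrm{Styl}(A)$. Let $\mathbb K$ be a field, and for $\gamma\in\Gamma(A)$ put $$e_\gamma=\prod^{\nearrow}_{a\notin\gamma}(1-a)\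 \prod^{\searrow}_{a\in\gamma}a\ \in\ \mathbb K\,\mathrm{Styl}(A),$$ the first product being taken in increasing and the second in decreasing order of the letters. Then for all $\gamma,\gamma'\in\Gamma(A)$, $$\dim_{\mathbb K}\bigl(e_\gamma\,\mathbb K\,\mathrm{Styl}(A)\,e_{\gamma'}\bigr)=\bigl|\{x\in\mathrm{Styl}(A):\ \eta(x)=\gamma\ \text{and}\ \theta(\eta(\theta(x)))=\gamma'\}\bigr|.$$ -/

import Mathlib

namespace Stylic

section Definitions

variable {A : Type*} [LinearOrder A]

/-- Schensted column insertion of the letter `a` into the column `γ`; a column is identified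
with the finite set of its entries. If some entry is `≥ a`, the smallest such entry is replaced
by `a`; otherwise `a` is added to the column. -/
def colInsert (a : A) (γ : Finset A) : Finset A :=
  if h : (γ.filter (fun y => a ≤ y)).Nonempty then
    insert a (γ.erase ((γ.filter (fun y => a ≤ y)).min' h))
  else insert a γ

/-- The homomorphism from words to endofunctions of the set of columns which gives the left
action: the last letter of a word acts first. -/
def mu : FreeMonoid A →* Function.End (Finset A) :=
  FreeMonoid.lift (fun a => (colInsert a : Function.End (Finset A)))

variable (A) in
/-- The stylic monoid: the endofunctions of the set of columns induced by words. -/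
abbrev Styl : Type _ := MonoidHom.mrange (mu (A := A))

/-- The class of a word in the stylic monoid. -/
def cls : FreeMonoid A →* Styl A := (mu (A := A)).mrangeRestrict

/-- The image of a letter in the stylic monoid. -/
def letter (a : A) : Styl A := cls (FreeMonoid.of a)

/-- A word representing a given element of the stylic monoid. -/
noncomputable def rep (x : Styl A) : FreeMonoid A := Classical.choose x.2

/-- The insertion of a letter `a` into an `N`-tableau, given by the list of its rows from bottom
to top. Rows are strictly increasing, so each is identified with the set of its entries. The
letter `a` is added to the bottom row (nothing is added if it is already there). If the row has
entries `> a`, the smallest of them stays in the row and is inserted in the same way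
into the tableau formed by the rows above. -/
def nInsert : List (Finset A) → A → List (Finset A)
  | [], a => [{a}]
  | R :: T, a =>
    if h : (R.filter (fun y => a < y)).Nonempty then
      insert a R :: nInsert T ((R.filter (fun y => a < y)).min' h)
    else insert a R :: T

/-- The `N`-tableau of a word: its letters are inserted from left to right into
the empty tableau. -/
def nTableau (w : FreeMonoid A) : List (Finset A) := w.toList.foldl nInsert []

/-- The first column of a tableau given by its rows: the set of the leftmost (that is, smallest)
entries of its rows. -/
def firstColumn [Fintype A] (T : List (Finset A)) : Finset A :=
  Finset.univ.filter (fun a => ∃ R ∈ T, a ∈ R ∧ ∀ b ∈ R, a ≤ b)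

/-- `eta x` is the first column of the `N`-tableau of `x`; it does not depend on
the chosen word, see `eta_cls`. -/
noncomputable def eta [Fintype A] (x : Styl A) : Finset A := firstColumn (nTableau (rep x))

variable [Fintype A]

/-- The order-reversing bijection of the alphabet. -/
noncomputable def revLetter (a : A) : A :=
  Fintype.orderIsoFinOfCardEq A rfl
    (Fin.rev ((Fintype.orderIsoFinOfCardEq A rfl).symm a))

/-- The involution induced on columns, seen as sets of letters. -/
noncomputable def thetaCol (γ : Finset A) : Finset A := γ.image revLetter

/-- The involutive anti-automorphism of the free monoid which reverses the order of letters. -/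
noncomputable def thetaWord (w : FreeMonoid A) : FreeMonoid A :=
  FreeMonoid.ofList ((w.toList.map revLetter).reverse)

/-- The anti-automorphism of the stylic monoid induced by `thetaWord`; it does not depend on
the chosen word, see `theta_cls`. -/
noncomputable def theta (x : Styl A) : Styl A := cls (thetaWord (rep x))

/-- The idempotent `e γ`: the product of `1 - a` over the letters `a ∉ γ` in increasing order,
times the product of the letters `a ∈ γ` in decreasing order. -/
noncomputable def e (K : Type*) [Field K] (γ : Finset A) : MonoidAlgebra K (Styl A) :=
  (((γᶜ).sort (fun a b => a ≤ b)).map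
      (fun a => 1 - MonoidAlgebra.of K (Styl A) (letter a))).prod *
    ((γ.sort (fun a b => a ≥ b)).map (fun a => MonoidAlgebra.of K (Styl A) (letter a))).prod

/-- The subspace `a Λ b` of an algebra `Λ`. -/
def peirce (K : Type*) [Field K] {L : Type*} [Ring L] [Algebra K L] (a b : L) : Submodule K L :=
  LinearMap.range (LinearMap.mulLeftRight K (a, b))

end Definitions

/-! The remaining facts show that `eta` and `theta` do not depend on the choice of words. -/

section WellDefined

variable {A : Type*} [LinearOrder A]

theorem mu_apply (w : FreeMonoid A) (γ : Finset A) :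
    mu w γ = w.toList.foldr colInsert γ := by
  induction w using FreeMonoid.inductionOn' generalizing γ with
  | one => rfl
  | of_mul a w ih =>
    rw [map_mul, FreeMonoid.toList_of_mul, List.foldr_cons, ← ih]
    rfl

theorem mem_colInsert {a y : A} {γ : Finset A} :
    y ∈ colInsert a γ ↔ y = a ∨ (y ∈ γ ∧ (a ≤ y → ∃ z ∈ γ, a ≤ z ∧ z < y)) := by
  unfold colInsert
  split_ifs with h
  · have hm := Finset.min'_mem _ h
    have hle : ∀ z ∈ γ.filter (fun y => a ≤ y), (γ.filter (fun y => a ≤ y)).min' h ≤ z :=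
      fun z hz => Finset.min'_le _ z hz
    generalize (γ.filter (fun y => a ≤ y)).min' h = m at hm hle ⊢
    simp only [Finset.mem_filter] at hm hle
    simp only [Finset.mem_insert, Finset.mem_erase]
    constructor
    · rintro (h1 | ⟨h1, h2⟩)
      · exact Or.inl h1
      · exact Or.inr ⟨h2, fun h3 => ⟨m, hm.1, hm.2, lt_of_le_of_ne (hle y ⟨h2, h3⟩) (Ne.symm h1)⟩⟩
    · rintro (h1 | ⟨h1, h2⟩)
      · exact Or.inl h1
      · refine Or.inr ⟨?_, h1⟩
        rintro rfl
        obtain ⟨z, hz, haz, hzy⟩ := h2 hm.2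
        exact absurd (hle z ⟨hz, haz⟩) (not_le.2 hzy)
  · simp only [Finset.mem_insert]
    constructor
    · rintro (h1 | h1)
      · exact Or.inl h1
      · exact Or.inr ⟨h1, fun h2 => absurd ⟨y, Finset.mem_filter.2 ⟨h1, h2⟩⟩ h⟩
    · rintro (h1 | h1)
      · exact Or.inl h1
      · exact Or.inr h1.1

/-- The number of entries of a column in a lower set, after insertion of a letter. -/
theorem le_card_colInsert (a : A) (γ : Finset A) (P : A → Prop) [DecidablePred P]
    (hP : ∀ x y, x ≤ y → P y → P x) (k : ℕ) :
    k ≤ ((colInsert a γ).filter P).card ↔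
      k ≤ (γ.filter P).card ∨ (P a ∧ k ≤ (γ.filter (fun y => y < a)).card + 1) := by
  by_cases hPa : P a
  · by_cases hy : (γ.filter (fun y => a ≤ y ∧ P y)).Nonempty
    · have hm := Finset.min'_mem _ hy
      have hle : ∀ z ∈ γ.filter (fun y => a ≤ y ∧ P y),
          (γ.filter (fun y => a ≤ y ∧ P y)).min' hy ≤ z :=
        fun z hz => Finset.min'_le _ z hz
      generalize (γ.filter (fun y => a ≤ y ∧ P y)).min' hy = m at hm hle
      simp only [Finset.mem_filter] at hm hle
      obtain ⟨hmγ, ham, hPm⟩ := hm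
      have h1 : (colInsert a γ).filter P = insert a ((γ.filter P).erase m) := by
        ext y
        simp only [Finset.mem_filter, mem_colInsert, Finset.mem_insert, Finset.mem_erase]
        constructor
        · rintro ⟨h | ⟨h2, h3⟩, h4⟩
          · exact Or.inl h
          · refine Or.inr ⟨?_, h2, h4⟩
            rintro rfl
            obtain ⟨z, hz, haz, hzy⟩ := h3 ham
            exact absurd (hle z ⟨hz, haz, hP _ _ hzy.le h4⟩) (not_le.2 hzy)
        · rintro (rfl | ⟨h2, h3, h4⟩)
          · exact ⟨Or.inl rfl, hPa⟩
          · exact ⟨Or.inr ⟨h3, fun h5 => ⟨m, hmγ, ham,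
              lt_of_le_of_ne (hle y ⟨h3, h5, h4⟩) (Ne.symm h2)⟩⟩, h4⟩
      have hmP : m ∈ γ.filter P := Finset.mem_filter.2 ⟨hmγ, hPm⟩
      have h2 : a ∉ (γ.filter P).erase m := by
        intro h
        rw [Finset.mem_erase, Finset.mem_filter] at h
        exact h.1 (le_antisymm ham (hle a ⟨h.2.1, le_rfl, hPa⟩))
      have h3 : (γ.filter (fun y => y < a)).card + 1 ≤ (γ.filter P).card := by
        rw [← Finset.card_erase_add_one hmP]
        refine Nat.succ_le_succ (Finset.card_le_card ?_)
        intro y hy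
        rw [Finset.mem_filter] at hy
        rw [Finset.mem_erase, Finset.mem_filter]
        exact ⟨(hy.2.trans_le ham).ne, hy.1, hP _ _ hy.2.le hPa⟩
      rw [h1, Finset.card_insert_of_notMem h2, Finset.card_erase_add_one hmP]
      constructor
      · exact Or.inl
      · rintro (h | h)
        · exact h
        · exact h.2.trans h3
    · have hno : ∀ y ∈ γ, P y → y < a := by
        intro y hyγ hPy
        by_contra hc
        exact hy ⟨y, Finset.mem_filter.2 ⟨hyγ, not_lt.1 hc, hPy⟩⟩
      have h1 : (colInsert a γ).filter P = insert a (γ.filter (fun y => y < a)) := by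
        ext y
        simp only [Finset.mem_filter, mem_colInsert, Finset.mem_insert]
        constructor
        · rintro ⟨h | ⟨h2, h3⟩, h4⟩
          · exact Or.inl h
          · exact Or.inr ⟨h2, hno y h2 h4⟩
        · rintro (rfl | ⟨h2, h3⟩)
          · exact ⟨Or.inl rfl, hPa⟩
          · exact ⟨Or.inr ⟨h2, fun h4 => absurd h4 (not_le.2 h3)⟩, hP _ _ h3.le hPa⟩
      have h2 : γ.filter P = γ.filter (fun y => y < a) := by
        ext y
        simp only [Finset.mem_filter]
        exact ⟨fun h => ⟨h.1, hno y h.1 h.2⟩, fun h => ⟨h.1, hP _ _ h.2.le hPa⟩⟩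
      rw [h1, h2, Finset.card_insert_of_notMem (by simp)]
      constructor
      · exact fun h => Or.inr ⟨hPa, h⟩
      · rintro (h | h)
        · exact h.trans (Nat.le_succ _)
        · exact h.2
  · have h1 : (colInsert a γ).filter P = γ.filter P := by
      ext y
      simp only [Finset.mem_filter, mem_colInsert]
      constructor
      · rintro ⟨rfl | h2, h3⟩
        · exact absurd h3 hPa
        · exact ⟨h2.1, h3⟩
      · rintro ⟨h2, h3⟩
        exact ⟨Or.inr ⟨h2, fun h4 => absurd (hP _ _ h4 h3) hPa⟩, h3⟩
    rw [h1]
    exact ⟨Or.inl, fun h => h.resolve_right (fun h2 => hPa h2.1)⟩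

/-- The number of entries of `w · γ` in a lower set, through strictly decreasing subwords
of `w`. -/
theorem le_card_foldr (w : List A) (γ : Finset A) (P : A → Prop) [DecidablePred P]
    (hP : ∀ x y, x ≤ y → P y → P x) (k : ℕ) :
    k ≤ ((w.foldr colInsert γ).filter P).card ↔
      ∃ l : List A, l.Sublist w ∧ l.Pairwise (· > ·) ∧ (∀ x ∈ l, P x) ∧
        k ≤ (γ.filter (fun y => P y ∧ ∀ x ∈ l, y < x)).card + l.length := by
  induction w generalizing P k with
  | nil =>
    constructor
    · intro h
      exact ⟨[], List.Sublist.refl _, List.Pairwise.nil, by simp, by simpa using h⟩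
    · rintro ⟨l, h1, -, -, h4⟩
      rw [List.sublist_nil] at h1
      subst h1
      simpa using h4
  | cons a w ih =>
    rw [List.foldr_cons, le_card_colInsert a _ P hP, ih P hP]
    constructor
    · rintro (⟨l, h1, h2, h3, h4⟩ | ⟨hPa, h⟩)
      · exact ⟨l, h1.cons a, h2, h3, h4⟩
      · have h' : k - 1 ≤ ((w.foldr colInsert γ).filter (fun y => y < a)).card := by omega
        obtain ⟨l, h1, h2, h3, h4⟩ :=
          (ih (fun y => y < a) (fun x y hxy hy => hxy.trans_lt hy) (k - 1)).1 h'
        refine ⟨a :: l, h1.cons_cons a, List.pairwise_cons.2 ⟨fun x hx => h3 x hx, h2⟩, ?_, ?_⟩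
        · intro x hx
          rcases List.mem_cons.1 hx with rfl | hx
          · exact hPa
          · exact hP _ _ (h3 x hx).le hPa
        · have : γ.filter (fun y => P y ∧ ∀ x ∈ a :: l, y < x) =
              γ.filter (fun y => y < a ∧ ∀ x ∈ l, y < x) := by
            ext y
            simp only [Finset.mem_filter, List.mem_cons, forall_eq_or_imp]
            exact ⟨fun h => ⟨h.1, h.2.2⟩, fun h => ⟨h.1, hP _ _ h.2.1.le hPa, h.2⟩⟩
          rw [this, List.length_cons]
          omega
    · rintro ⟨l, h1, h2, h3, h4⟩
      cases h1 with
      | cons _ h1 => exact Or.inl ⟨l, h1, h2, h3, h4⟩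
      | cons_cons _ h1 =>
        rename_i l
        rw [List.pairwise_cons] at h2
        have hPa : P a := h3 a (by simp)
        refine Or.inr ⟨hPa, ?_⟩
        have h' : k - 1 ≤ ((w.foldr colInsert γ).filter (fun y => y < a)).card := by
          rw [ih (fun y => y < a) (fun x y hxy hy => hxy.trans_lt hy)]
          refine ⟨l, h1, h2.2, h2.1, ?_⟩
          have : γ.filter (fun y => P y ∧ ∀ x ∈ a :: l, y < x) =
              γ.filter (fun y => y < a ∧ ∀ x ∈ l, y < x) := by
            ext y
            simp only [Finset.mem_filter, List.mem_cons, forall_eq_or_imp]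
            exact ⟨fun h => ⟨h.1, h.2.2⟩, fun h => ⟨h.1, hP _ _ h.2.1.le hPa, h.2⟩⟩
          rw [this, List.length_cons] at h4
          omega
        omega

/-- Every strictly decreasing subword of `u` is matched by one of `v` which is at least as long
and has its letters in the same interval. -/
def DecLE (u v : List A) : Prop :=
  ∀ (s t : A) (l : List A), l.Sublist u → l.Pairwise (· > ·) → (∀ x ∈ l, s ≤ x ∧ x ≤ t) →
    ∃ l' : List A, l'.Sublist v ∧ l'.Pairwise (· > ·) ∧ (∀ x ∈ l', s ≤ x ∧ x ≤ t) ∧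
      l.length ≤ l'.length

theorem card_le_of_decLE {u v : List A} (h : DecLE u v) (γ : Finset A) (P : A → Prop)
    [DecidablePred P] (hP : ∀ x y, x ≤ y → P y → P x) :
    ((u.foldr colInsert γ).filter P).card ≤ ((v.foldr colInsert γ).filter P).card := by
  rw [le_card_foldr v γ P hP]
  obtain ⟨l, h1, h2, h3, h4⟩ := (le_card_foldr u γ P hP _).1 le_rfl
  rcases eq_or_ne l [] with rfl | hl
  · exact ⟨[], List.nil_sublist _, List.Pairwise.nil, by simp, h4⟩
  · have hne : l.toFinset.Nonempty := by
      obtain ⟨x, hx⟩ := List.exists_mem_of_ne_nil l hl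
      exact ⟨x, List.mem_toFinset.2 hx⟩
    have hs := List.mem_toFinset.1 (Finset.min'_mem _ hne)
    have ht := List.mem_toFinset.1 (Finset.max'_mem _ hne)
    obtain ⟨l', h5, h6, h7, h8⟩ := h (l.toFinset.min' hne) (l.toFinset.max' hne) l h1 h2
      (fun x hx => ⟨Finset.min'_le _ _ (List.mem_toFinset.2 hx),
        Finset.le_max' _ _ (List.mem_toFinset.2 hx)⟩)
    refine ⟨l', h5, h6, fun x hx => hP _ _ (h7 x hx).2 (h3 _ ht), h4.trans ?_⟩
    refine Nat.add_le_add (Finset.card_le_card ?_) h8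
    intro y hy
    rw [Finset.mem_filter] at hy ⊢
    exact ⟨hy.1, hy.2.1, fun x hx => (hy.2.2 _ hs).trans_le (h7 x hx).1⟩

theorem subset_of_card {δ δ' : Finset A}
    (h : ∀ (P : A → Prop) [DecidablePred P], (∀ x y, x ≤ y → P y → P x) →
      (δ.filter P).card = (δ'.filter P).card) : δ ⊆ δ' := by
  intro a ha
  by_contra hc
  have h1 := h (fun y => y ≤ a) (fun x y hxy hy => hxy.trans hy)
  have h2 := h (fun y => y < a) (fun x y hxy hy => hxy.trans_lt hy)
  have h3 : δ'.filter (fun y => y ≤ a) = δ'.filter (fun y => y < a) := by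
    ext y
    simp only [Finset.mem_filter]
    refine ⟨fun h => ⟨h.1, lt_of_le_of_ne h.2 ?_⟩, fun h => ⟨h.1, h.2.le⟩⟩
    rintro rfl
    exact hc h.1
  have h4 : (δ.filter (fun y => y < a)).card < (δ.filter (fun y => y ≤ a)).card := by
    refine Finset.card_lt_card (Finset.ssubset_iff_subset_ne.2 ⟨?_, ?_⟩)
    · intro y hy
      rw [Finset.mem_filter] at hy ⊢
      exact ⟨hy.1, hy.2.le⟩
    · intro he
      have : a ∈ δ.filter (fun y => y < a) := by
        rw [he]
        exact Finset.mem_filter.2 ⟨ha, le_rfl⟩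
      simp at this
  rw [h3] at h1
  omega

theorem foldr_eq_of_decLE {u v : List A} (h : DecLE u v) (h' : DecLE v u) (γ : Finset A) :
    u.foldr colInsert γ = v.foldr colInsert γ := by
  have key : ∀ (P : A → Prop) [DecidablePred P], (∀ x y, x ≤ y → P y → P x) →
      ((u.foldr colInsert γ).filter P).card = ((v.foldr colInsert γ).filter P).card :=
    fun P _ hP => le_antisymm (card_le_of_decLE h γ P hP) (card_le_of_decLE h' γ P hP)
  exact Finset.Subset.antisymm (subset_of_card key)
    (subset_of_card fun P _ hP => (key P hP).symm)

theorem decLE_of_foldr_eq {u v : List A}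
    (hA : ∀ s : A, ∃ γ : Finset A, ∀ y, y ∈ γ ↔ y < s)
    (h : ∀ γ : Finset A, u.foldr colInsert γ = v.foldr colInsert γ) : DecLE u v := by
  intro s t l h1 h2 h3
  rcases eq_or_ne l [] with rfl | hl
  · exact ⟨[], List.nil_sublist _, List.Pairwise.nil, by simp, le_rfl⟩
  · obtain ⟨x, hx⟩ := List.exists_mem_of_ne_nil l hl
    have hst : s ≤ t := (h3 x hx).1.trans (h3 x hx).2
    obtain ⟨γ, hγ⟩ := hA s
    have hP : ∀ x y : A, x ≤ y → y ≤ t → x ≤ t := fun x y hxy hy => hxy.trans hy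
    have h4 : γ.card + l.length ≤ ((u.foldr colInsert γ).filter (fun y => y ≤ t)).card := by
      rw [le_card_foldr u γ (fun y => y ≤ t) hP]
      refine ⟨l, h1, h2, fun x hx => (h3 x hx).2, Nat.add_le_add (Finset.card_le_card ?_) le_rfl⟩
      intro y hy
      have hy' : y < s := by simpa [hγ] using hy
      exact Finset.mem_filter.2 ⟨hy, hy'.le.trans hst, fun x hx => hy'.trans_le (h3 x hx).1⟩
    rw [h, le_card_foldr v γ (fun y => y ≤ t) hP] at h4
    obtain ⟨l', h5, h6, h7, h8⟩ := h4
    refine ⟨l'.filter (fun x => s ≤ x), List.filter_sublist.trans h5, h6.filter _, ?_, ?_⟩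
    · intro x hx
      rw [List.mem_filter] at hx
      exact ⟨by simpa using hx.2, h7 x hx.1⟩
    · have hnd : l'.Nodup := h6.imp (fun h => ne_of_gt h)
      have h9 : (l'.filter (fun x => ¬ s ≤ x)).length +
          (γ.filter (fun y => y ≤ t ∧ ∀ x ∈ l', y < x)).card ≤ γ.card := by
        rw [← List.toFinset_card_of_nodup (hnd.filter _), ← Finset.card_union_of_disjoint]
        · refine Finset.card_le_card ?_
          intro y hy
          rw [Finset.mem_union] at hy
          rcases hy with hy | hy
          · simpa [hγ] using (List.mem_filter.1 (List.mem_toFinset.1 hy)).2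
          · exact (Finset.mem_filter.1 hy).1
        · rw [Finset.disjoint_left]
          intro y hy hy'
          exact lt_irrefl _ ((Finset.mem_filter.1 hy').2.2 y
            (List.mem_filter.1 (List.mem_toFinset.1 hy)).1)
      have h10 : l'.length = (l'.filter (fun x => s ≤ x)).length +
          (l'.filter (fun x => ¬ s ≤ x)).length := by
        have := List.length_eq_length_filter_add (l := l') (fun x => decide (s ≤ x))
        simpa only [decide_not] using this
      omega

/-- Two words have the same action on columns if and only if, for every interval, the longest
strictly decreasing subwords with letters in the interval have the same length. -/
theorem mu_eq_iff [Fintype A] {u v : FreeMonoid A} :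
    mu u = mu v ↔ DecLE u.toList v.toList ∧ DecLE v.toList u.toList := by
  constructor
  · intro h
    have h' : ∀ γ : Finset A, u.toList.foldr colInsert γ = v.toList.foldr colInsert γ := by
      intro γ
      rw [← mu_apply, ← mu_apply, h]
    have hA : ∀ s : A, ∃ γ : Finset A, ∀ y, y ∈ γ ↔ y < s :=
      fun s => ⟨Finset.univ.filter (fun y => y < s), by simp⟩
    exact ⟨decLE_of_foldr_eq hA h', decLE_of_foldr_eq hA fun γ => (h' γ).symm⟩
  · intro h
    funext γ
    rw [mu_apply, mu_apply, foldr_eq_of_decLE h.1 h.2]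

theorem cls_eq_iff {u v : FreeMonoid A} : cls u = cls v ↔ mu u = mu v := by
  rw [Subtype.ext_iff]
  rfl

theorem mu_rep (x : Styl A) : mu (rep x) = x.1 := Classical.choose_spec x.2

theorem cls_rep (x : Styl A) : cls (rep x) = x := Subtype.ext (mu_rep x)

theorem mu_rep_cls (w : FreeMonoid A) : mu (rep (cls w)) = mu w := mu_rep (cls w)

theorem revLetter_revLetter [Fintype A] (a : A) : revLetter (revLetter a) = a := by
  simp [revLetter]

theorem revLetter_lt [Fintype A] {a b : A} : revLetter a < revLetter b ↔ b < a := by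
  simp [revLetter]

theorem revLetter_le [Fintype A] {a b : A} : revLetter a ≤ revLetter b ↔ b ≤ a := by
  simp [revLetter]

theorem decLE_thetaWord [Fintype A] {u v : List A} (h : DecLE u v) :
    DecLE (u.map revLetter).reverse (v.map revLetter).reverse := by
  intro s t l h1 h2 h3
  have hrr : (revLetter : A → A) ∘ revLetter = id := funext revLetter_revLetter
  obtain ⟨l', h4, h5, h6, h7⟩ := h (revLetter t) (revLetter s) (l.map revLetter).reverse
    (by
      have := (h1.map revLetter).reverse
      simpa [List.map_reverse, hrr] using this)
    (by
      rw [List.pairwise_reverse, List.pairwise_map]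
      exact h2.imp fun h => revLetter_lt.2 h)
    (by
      intro x hx
      rw [List.mem_reverse, List.mem_map] at hx
      obtain ⟨y, hy, rfl⟩ := hx
      exact ⟨revLetter_le.2 (h3 y hy).2, revLetter_le.2 (h3 y hy).1⟩)
  refine ⟨(l'.map revLetter).reverse, (h4.map revLetter).reverse, ?_, ?_, by simpa using h7⟩
  · rw [List.pairwise_reverse, List.pairwise_map]
    exact h5.imp fun h => revLetter_lt.2 h
  · intro x hx
    rw [List.mem_reverse, List.mem_map] at hx
    obtain ⟨y, hy, rfl⟩ := hx
    have h8 := h6 y hy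
    constructor
    · rw [← revLetter_revLetter s]
      exact revLetter_le.2 h8.2
    · rw [← revLetter_revLetter t]
      exact revLetter_le.2 h8.1

/-- The map `theta` on the stylic monoid is induced by the one on words. -/
theorem theta_cls [Fintype A] (w : FreeMonoid A) : theta (cls w) = cls (thetaWord w) := by
  have h := mu_eq_iff.1 (mu_rep_cls w)
  exact cls_eq_iff.2 (mu_eq_iff.2 ⟨decLE_thetaWord h.1, decLE_thetaWord h.2⟩)

/-- The row-reading word of a tableau given by its rows. -/
def rowWord : List (Finset A) → List A
  | [] => []
  | R :: T => rowWord T ++ R.sort (fun a b => a ≤ b)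

theorem length_le_one_of_sublist_sort {R : Finset A} {l : List A}
    (h1 : l.Sublist (R.sort (fun a b => a ≤ b))) (h2 : l.Pairwise (· > ·)) : l.length ≤ 1 := by
  have h3 := (Finset.pairwise_sort R (fun a b => a ≤ b)).sublist h1
  match l, h2, h3 with
  | [], _, _ => simp
  | [_], _, _ => simp
  | a :: b :: l, h2, h3 =>
    have h4 := (List.pairwise_cons.1 h2).1 b (by simp)
    have h5 := (List.pairwise_cons.1 h3).1 b (by simp)
    exact absurd h4 (not_lt.2 h5)

theorem foldr_row (R : Finset A) (a y : A) (hy : y ∈ R) (hay : a < y)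
    (hmin : ∀ z ∈ R, a < z → y ≤ z) (γ : Finset A) :
    (R.sort (fun a b => a ≤ b) ++ [a]).foldr colInsert γ =
      (y :: (insert a R).sort (fun a b => a ≤ b)).foldr colInsert γ := by
  apply foldr_eq_of_decLE
  · intro s t l h1 h2 h3
    obtain ⟨l1, l2, rfl, h4, h5⟩ := List.sublist_append_iff.1 h1
    have h6 := length_le_one_of_sublist_sort h4 (List.pairwise_append.1 h2).1
    have h7 : l2 = [] ∨ l2 = [a] := by simpa using List.sublist_singleton.1 h5
    have hsing : ∀ r ∈ insert a R, [r].Sublist (y :: (insert a R).sort (fun a b => a ≤ b)) := by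
      intro r hr
      rw [List.singleton_sublist]
      exact List.mem_cons_of_mem _ ((Finset.mem_sort _).2 hr)
    match l1, h6 with
    | [], _ =>
      rcases h7 with rfl | rfl
      · exact ⟨[], by simp, by simp, by simp, by simp⟩
      · exact ⟨[a], hsing a (by simp), by simp, by simpa using h3, by simp⟩
    | [r], _ =>
      have hr : r ∈ R := by
        rw [List.singleton_sublist, Finset.mem_sort] at h4
        exact h4
      rcases h7 with rfl | rfl
      · exact ⟨[r], hsing r (by simp [hr]), by simp, by simpa using h3, by simp⟩
      · have har : a < r := by simpa using h2
        have h8 := h3 r (by simp)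
        have h9 := h3 a (by simp)
        have hyr := hmin r hr har
        refine ⟨[y, a], ?_, by simpa using hay, ?_, by simp⟩
        · refine List.Sublist.cons_cons _ ?_
          rw [List.singleton_sublist, Finset.mem_sort]
          simp
        · intro x hx
          simp only [List.mem_cons, List.not_mem_nil, or_false] at hx
          rcases hx with rfl | rfl
          · exact ⟨h9.1.trans hay.le, hyr.trans h8.2⟩
          · exact h9
    | _ :: _ :: _, h6 => simp at h6
  · intro s t l h1 h2 h3
    have hsing : ∀ r ∈ insert a R, [r].Sublist (R.sort (fun a b => a ≤ b) ++ [a]) := by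
      intro r hr
      rw [List.singleton_sublist]
      simp only [List.mem_append, Finset.mem_sort, List.mem_singleton]
      exact (Finset.mem_insert.1 hr).symm
    cases h1 with
    | cons _ h1 =>
      have h6 := length_le_one_of_sublist_sort h1 h2
      match l, h6 with
      | [], _ => exact ⟨[], by simp, by simp, by simp, by simp⟩
      | [r], _ =>
        rw [List.singleton_sublist, Finset.mem_sort] at h1
        exact ⟨[r], hsing r h1, by simp, h3, by simp⟩
      | _ :: _ :: _, h6 => simp at h6
    | cons_cons _ h1 =>
      rename_i l
      have h6 := length_le_one_of_sublist_sort h1 (List.pairwise_cons.1 h2).2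
      match l, h6 with
      | [], _ => exact ⟨[y], hsing y (by simp [hy]), by simp, h3, by simp⟩
      | [r], _ =>
        rw [List.singleton_sublist, Finset.mem_sort] at h1
        have hry : r < y := by simpa using h2
        have hra : r ≤ a := by
          rcases Finset.mem_insert.1 h1 with h | h
          · exact h.le
          · by_contra hc
            exact absurd (hmin r h (not_le.1 hc)) (not_le.2 hry)
        have h8 := h3 y (by simp)
        have h9 := h3 r (by simp)
        refine ⟨[y, a], ?_, by simpa using hay, ?_, by simp⟩
        · have : [y].Sublist (R.sort (fun a b => a ≤ b)) := by
            rw [List.singleton_sublist, Finset.mem_sort]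
            exact hy
          exact this.append (List.Sublist.refl [a])
        · intro x hx
          simp only [List.mem_cons, List.not_mem_nil, or_false] at hx
          rcases hx with rfl | rfl
          · exact h8
          · exact ⟨h9.1.trans hra, hay.le.trans h8.2⟩
      | _ :: _ :: _, h6 => simp at h6

theorem foldr_row_last (R : Finset A) (a : A) (ha : ∀ z ∈ R, z ≤ a) (γ : Finset A) :
    (R.sort (fun a b => a ≤ b) ++ [a]).foldr colInsert γ =
      ((insert a R).sort (fun a b => a ≤ b)).foldr colInsert γ := by
  apply foldr_eq_of_decLE
  · intro s t l h1 h2 h3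
    obtain ⟨l1, l2, rfl, h4, h5⟩ := List.sublist_append_iff.1 h1
    have h6 := length_le_one_of_sublist_sort h4 (List.pairwise_append.1 h2).1
    have h7 : l2 = [] ∨ l2 = [a] := by simpa using List.sublist_singleton.1 h5
    have hsing : ∀ r ∈ insert a R, [r].Sublist ((insert a R).sort (fun a b => a ≤ b)) := by
      intro r hr
      rw [List.singleton_sublist]
      exact (Finset.mem_sort _).2 hr
    match l1, h6 with
    | [], _ =>
      rcases h7 with rfl | rfl
      · exact ⟨[], by simp, by simp, by simp, by simp⟩
      · exact ⟨[a], hsing a (by simp), by simp, by simpa using h3, by simp⟩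
    | [r], _ =>
      have hr : r ∈ R := by
        rw [List.singleton_sublist, Finset.mem_sort] at h4
        exact h4
      rcases h7 with rfl | rfl
      · exact ⟨[r], hsing r (by simp [hr]), by simp, by simpa using h3, by simp⟩
      · have har : a < r := by simpa using h2
        exact absurd (ha r hr) (not_le.2 har)
    | _ :: _ :: _, h6 => simp at h6
  · intro s t l h1 h2 h3
    have h6 := length_le_one_of_sublist_sort h1 h2
    match l, h6 with
    | [], _ => exact ⟨[], by simp, by simp, by simp, by simp⟩
    | [r], _ =>
      rw [List.singleton_sublist, Finset.mem_sort] at h1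
      refine ⟨[r], ?_, by simp, h3, by simp⟩
      rw [List.singleton_sublist]
      simp only [List.mem_append, Finset.mem_sort, List.mem_singleton]
      exact (Finset.mem_insert.1 h1).symm
    | _ :: _ :: _, h6 => simp at h6

theorem foldr_rowWord_nInsert (T : List (Finset A)) (a : A) (γ : Finset A) :
    (rowWord (nInsert T a)).foldr colInsert γ = (rowWord T ++ [a]).foldr colInsert γ := by
  induction T generalizing a γ with
  | nil => simp [nInsert, rowWord]
  | cons R T ih =>
    rw [nInsert]
    split_ifs with h
    · have hm := Finset.min'_mem _ h
      have hle : ∀ z ∈ R.filter (fun y => a < y), (R.filter (fun y => a < y)).min' h ≤ z :=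
        fun z hz => Finset.min'_le _ z hz
      generalize (R.filter (fun y => a < y)).min' h = y at hm hle ⊢
      simp only [Finset.mem_filter] at hm hle
      rw [rowWord, rowWord, List.foldr_append, ih, List.append_assoc, List.foldr_append,
        List.foldr_append, foldr_row R a y hm.1 hm.2 (fun z hz haz => hle z ⟨hz, haz⟩)]
      rfl
    · have hR : ∀ z ∈ R, z ≤ a := by
        intro z hz
        by_contra hc
        exact h ⟨z, Finset.mem_filter.2 ⟨hz, not_le.1 hc⟩⟩
      rw [rowWord, rowWord, List.append_assoc, List.foldr_append, List.foldr_append,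
        foldr_row_last R a hR]

theorem foldr_rowWord_foldl (w : List A) (T : List (Finset A)) (γ : Finset A) :
    (rowWord (w.foldl nInsert T)).foldr colInsert γ = (rowWord T ++ w).foldr colInsert γ := by
  induction w generalizing T with
  | nil => simp
  | cons a w ih =>
    rw [List.foldl_cons, ih, List.foldr_append, foldr_rowWord_nInsert, ← List.foldr_append]
    simp

/-- The smallest entries of the rows strictly increase from bottom to top. -/
def RowsOK : List (Finset A) → Prop
  | [] => True
  | R :: T => (∃ r ∈ R, ∀ S ∈ T, ∀ x ∈ S, r < x) ∧ RowsOK T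

theorem lt_nInsert (T : List (Finset A)) (a c : A) (hc : c < a)
    (hT : ∀ S ∈ T, ∀ x ∈ S, c < x) : ∀ S ∈ nInsert T a, ∀ x ∈ S, c < x := by
  induction T generalizing a with
  | nil =>
    intro S hS x hx
    simp only [nInsert, List.mem_singleton] at hS
    subst hS
    rw [Finset.mem_singleton] at hx
    rwa [hx]
  | cons R T ih =>
    have hR : ∀ x ∈ insert a R, c < x := by
      intro x hx
      rcases Finset.mem_insert.1 hx with rfl | hx
      · exact hc
      · exact hT R (by simp) x hx
    rw [nInsert]
    split_ifs with h
    · have hm := (Finset.mem_filter.1 (Finset.min'_mem _ h)).2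
      intro S hS
      rcases List.mem_cons.1 hS with rfl | hS
      · exact hR
      · exact ih _ (hc.trans hm) (fun S hS => hT S (by simp [hS])) S hS
    · intro S hS
      rcases List.mem_cons.1 hS with rfl | hS
      · exact hR
      · exact hT S (by simp [hS])

theorem rowsOK_nInsert (T : List (Finset A)) (a : A) (hT : RowsOK T) : RowsOK (nInsert T a) := by
  induction T generalizing a with
  | nil => exact ⟨⟨a, by simp, by simp⟩, trivial⟩
  | cons R T ih =>
    obtain ⟨⟨r, hr, hrT⟩, hT⟩ := hT
    rw [nInsert]
    split_ifs with h
    · have hm := (Finset.mem_filter.1 (Finset.min'_mem _ h)).2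
      refine ⟨?_, ih _ hT⟩
      rcases le_total r a with hra | hra
      · exact ⟨r, Finset.mem_insert_of_mem hr, lt_nInsert _ _ _ (hra.trans_lt hm) hrT⟩
      · exact ⟨a, Finset.mem_insert_self _ _, lt_nInsert _ _ _ hm
          (fun S hS x hx => hra.trans_lt (hrT S hS x hx))⟩
    · exact ⟨⟨r, Finset.mem_insert_of_mem hr, hrT⟩, hT⟩

theorem rowsOK_foldl (w : List A) (T : List (Finset A)) (hT : RowsOK T) :
    RowsOK (w.foldl nInsert T) := by
  induction w generalizing T with
  | nil => exact hT
  | cons a w ih => exact ih _ (rowsOK_nInsert T a hT)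

theorem colInsert_of_lt (a : A) (γ : Finset A) (h : ∀ x ∈ γ, x < a) :
    colInsert a γ = insert a γ := by
  ext y
  rw [mem_colInsert, Finset.mem_insert]
  exact ⟨fun h1 => h1.imp_right fun h2 => h2.1,
    fun h1 => h1.imp_right fun h2 => ⟨h2, fun h3 => absurd (h y h2) (not_lt.2 h3)⟩⟩

theorem foldr_increasing (l : List A) (hl : l.Pairwise (· ≤ ·)) (m : A) (hm : m ∈ l)
    (hle : ∀ x ∈ l, m ≤ x) (γ : Finset A) (hγ : ∀ x ∈ γ, x < m) :
    l.foldr colInsert γ = insert m γ := by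
  induction l generalizing m with
  | nil => simp at hm
  | cons a l ih =>
    rw [List.pairwise_cons] at hl
    have ham : m = a := by
      refine le_antisymm (hle a (by simp)) ?_
      rcases List.mem_cons.1 hm with h | h
      · exact h.ge
      · exact hl.1 m h
    subst ham
    rw [List.foldr_cons]
    match l, hl, ih with
    | [], _, _ => exact colInsert_of_lt _ _ hγ
    | b :: l, hl, ih =>
      have hmb : m ≤ b := hl.1 b (by simp)
      rw [ih hl.2 b (by simp) (by
        intro x hx
        rcases List.mem_cons.1 hx with rfl | hx
        · exact le_rfl
        · exact (List.pairwise_cons.1 hl.2).1 x hx)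
        (fun x hx => (hγ x hx).trans_le hmb)]
      ext y
      rw [mem_colInsert, Finset.mem_insert, Finset.mem_insert]
      constructor
      · rintro (h | ⟨rfl | h, h2⟩)
        · exact Or.inl h
        · obtain ⟨z, hz, h3, h4⟩ := h2 hmb
          rcases Finset.mem_insert.1 hz with rfl | hz
          · exact absurd h4 (lt_irrefl _)
          · exact absurd (hγ z hz) (not_lt.2 h3)
        · exact Or.inr h
      · rintro (h | h)
        · exact Or.inl h
        · exact Or.inr ⟨Or.inr h, fun h2 => absurd (hγ y h) (not_lt.2 h2)⟩

theorem mem_foldr_rowWord (T : List (Finset A)) (hT : RowsOK T) (γ : Finset A)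
    (hγ : ∀ x ∈ γ, ∀ S ∈ T, ∀ y ∈ S, x < y) (a : A) :
    a ∈ (rowWord T).foldr colInsert γ ↔ a ∈ γ ∨ ∃ R ∈ T, a ∈ R ∧ ∀ b ∈ R, a ≤ b := by
  induction T generalizing γ with
  | nil => simp [rowWord]
  | cons R T ih =>
    obtain ⟨⟨r, hr, hrT⟩, hT⟩ := hT
    have hm := Finset.min'_mem R ⟨r, hr⟩
    have hle : ∀ z ∈ R, R.min' ⟨r, hr⟩ ≤ z := fun z hz => Finset.min'_le _ z hz
    generalize R.min' ⟨r, hr⟩ = m at hm hle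
    rw [rowWord, List.foldr_append, foldr_increasing _ (Finset.pairwise_sort R _) m
      ((Finset.mem_sort _).2 hm) (fun x hx => hle x ((Finset.mem_sort _).1 hx)) γ
      (fun x hx => hγ x hx R (by simp) m hm), ih hT]
    · rw [Finset.mem_insert]
      constructor
      · rintro ((rfl | h) | ⟨S, hS, h⟩)
        · exact Or.inr ⟨R, by simp, hm, hle⟩
        · exact Or.inl h
        · exact Or.inr ⟨S, by simp [hS], h⟩
      · rintro (h | ⟨S, hS, h1, h2⟩)
        · exact Or.inl (Or.inr h)
        · rcases List.mem_cons.1 hS with rfl | hS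
          · exact Or.inl (Or.inl (le_antisymm (h2 m hm) (hle a h1)))
          · exact Or.inr ⟨S, hS, h1, h2⟩
    · intro x hx S hS y hy
      rcases Finset.mem_insert.1 hx with rfl | hx
      · exact (hle r hr).trans_lt (hrT S hS y hy)
      · exact hγ x hx S (by simp [hS]) y hy

/-- The first column of the `N`-tableau of `w` is `w · ∅`; hence it depends only on the
class of `w`. -/
theorem firstColumn_nTableau [Fintype A] (w : FreeMonoid A) :
    firstColumn (nTableau w) = mu w ∅ := by
  have h1 : w.toList.foldr colInsert ∅ = (rowWord (nTableau w)).foldr colInsert ∅ := by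
    rw [nTableau, foldr_rowWord_foldl]
    simp [rowWord]
  ext a
  have h2 : RowsOK (nTableau w) := rowsOK_foldl _ [] trivial
  rw [mu_apply, h1, mem_foldr_rowWord _ h2 _ (by simp)]
  simp [firstColumn]

/-- The map `eta` is the first column of the `N`-tableau of any representing word. -/
theorem eta_cls [Fintype A] (w : FreeMonoid A) : eta (cls w) = firstColumn (nTableau w) := by
  rw [eta, firstColumn_nTableau, firstColumn_nTableau, mu_rep_cls]

instance [Fintype A] : Finite (Styl A) :=
  have : Finite (Function.End (Finset A)) := inferInstanceAs (Finite (Finset A → Finset A))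
  Finite.of_injective (fun x : Styl A => x.1) Subtype.val_injective

end WellDefined

end Stylic

namespace Stylic

set_option linter.unusedSectionVars false

/-! The letters fixing `x` on the left are exactly those of `eta x` (`mem_eta`). Since `theta`
exchanges the two sides, those fixing `x` on the right form `thetaCol (eta (theta x))`, called
`etaRight x` (`mem_etaRight`). The monoid is `J`-trivial, so multiplying `x` by any other letter
gives an element with a strictly smaller two-sided ideal. In `e (eta x) * x * e (etaRight x)` the
decreasing products therefore fix `x`, while each factor `1 - a` changes it only by lower terms. So
`peirceMap`, which sends `x` to this element, is unitriangular, hence bijective.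

This adapts the basis of monoid elements to the Peirce decomposition once the `e γ` are known to be
orthogonal idempotents of sum 1. The sum telescopes (`sum_e`). Orthogonality (`e_mul_e`) follows
from the directness of the sum of the right ideals of the `e γ`: each lies in the image, under the
injective `leftPeirceMap`, of the span of the `x` with `eta x = γ` (`exists_leftPeirceMap_eq`), and
these spans are independent. Multiplying by `e γ` and `e γ'` then keeps exactly the images of the
`x` with `eta x = γ` and `etaRight x = γ'`, and these are counted. -/

theorem _root_.Module.Basis.injective_of_unitriangular {ι K V : Type*} [Field K] [AddCommGroup V]
    [Module K V] (b : Module.Basis ι K V) (r : ι → ℕ) (f : V →ₗ[K] V)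
    (h : ∀ i, f (b i) - b i ∈ Submodule.span K (b '' {j | r j < r i})) :
    Function.Injective f := by
  rw [← LinearMap.ker_eq_bot, LinearMap.ker_eq_bot']
  intro v hv
  by_contra hne
  have hs : (b.repr v).support.Nonempty := by
    rw [Finsupp.support_nonempty_iff]
    simpa using hne
  -- Take an index of maximal rank in the support of a nonzero kernel vector `v`. Then `f v - v =
  -- -v` only involves ranks below `r i`, which contradicts the presence of `i` in the support.
  obtain ⟨i, hi, hmax⟩ := Finset.exists_max_image _ r hs
  have h1 : v ∈ Submodule.span K (b '' {j | r j ≤ r i}) :=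
    b.mem_span_image.2 fun j hj => hmax j hj
  have h2 : Submodule.span K (b '' {j | r j ≤ r i}) ≤
      (Submodule.span K (b '' {j | r j < r i})).comap (f - LinearMap.id) := by
    rw [Submodule.span_le]
    rintro _ ⟨j, hj, rfl⟩
    refine Submodule.span_mono (Set.image_mono ?_) (h j)
    exact fun k (hk : r k < r j) => hk.trans_le hj
  have h3 : f v - v ∈ Submodule.span K (b '' {j | r j < r i}) := h2 h1
  rw [hv, zero_sub, Submodule.neg_mem_iff, b.mem_span_image] at h3
  have h4 : r i < r i := h3 hi
  exact lt_irrefl _ h4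

/-! ### `J`-triviality, and the letters fixing an element on either side -/

section Order

variable {A : Type*} [LinearOrder A] [Fintype A]

theorem decLE_of_sublist {u v : List A} (h : u.Sublist v) : DecLE u v :=
  fun _ _ l h1 h2 h3 => ⟨l, h1.trans h, h2, h3, le_rfl⟩

theorem DecLE.trans {u v w : List A} (h : DecLE u v) (h' : DecLE v w) : DecLE u w := by
  intro s t l h1 h2 h3
  obtain ⟨l', h4, h5, h6, h7⟩ := h s t l h1 h2 h3
  obtain ⟨l'', h8, h9, h10, h11⟩ := h' s t l' h4 h5 h6
  exact ⟨l'', h8, h9, h10, h7.trans h11⟩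

theorem cls_surjective : Function.Surjective (cls (A := A)) := fun x => ⟨rep x, cls_rep x⟩

/-- The stylic monoid is `J`-trivial. -/
theorem mul_mul_eq_of_eq (x u v s t : Styl A) (h : s * (u * x * v) * t = x) : u * x * v = x := by
  obtain ⟨x, rfl⟩ := cls_surjective x
  obtain ⟨u, rfl⟩ := cls_surjective u
  obtain ⟨v, rfl⟩ := cls_surjective v
  obtain ⟨s, rfl⟩ := cls_surjective s
  obtain ⟨t, rfl⟩ := cls_surjective t
  simp only [← map_mul, cls_eq_iff, mu_eq_iff] at h ⊢
  -- Enlarging a word only adds decreasing subwords, so `x ≤ u x v ≤ s (u x v) t` for `DecLE`. The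
  -- two ends agree in the monoid, which closes the cycle.
  have h1 : DecLE (u * x * v).toList (s * (u * x * v) * t).toList := by
    apply decLE_of_sublist
    simp only [FreeMonoid.toList_mul]
    exact (List.sublist_append_right _ _).trans (List.sublist_append_left _ _)
  have h2 : DecLE x.toList (u * x * v).toList := by
    apply decLE_of_sublist
    simp only [FreeMonoid.toList_mul]
    exact (List.sublist_append_right _ _).trans (List.sublist_append_left _ _)
  exact ⟨h1.trans h.1, h2⟩

/-- The number of elements of the two-sided ideal generated by `x`. -/
noncomputable def idealCard (x : Styl A) : ℕ := {y : Styl A | ∃ u v, u * x * v = y}.ncard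

/-- The ideal of `u * x * v` is contained in that of `x`, and `J`-triviality keeps `x` itself out of
it. -/
theorem idealCard_lt {x u v : Styl A} (h : u * x * v ≠ x) : idealCard (u * x * v) < idealCard x := by
  refine Set.ncard_lt_ncard ((Set.ssubset_iff_of_subset ?_).2 ⟨x, ⟨1, 1, by simp⟩, ?_⟩)
    (Set.toFinite _)
  · rintro _ ⟨s, t, rfl⟩
    exact ⟨s * u, v * t, by simp only [mul_assoc]⟩
  · rintro ⟨s, t, hst⟩
    exact h (mul_mul_eq_of_eq x u v s t hst)

theorem idealCard_le (x u v : Styl A) : idealCard (u * x * v) ≤ idealCard x := by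
  by_cases h : u * x * v = x
  · rw [h]
  · exact (idealCard_lt h).le

theorem colInsert_eq_self_iff {a : A} {γ : Finset A} : colInsert a γ = γ ↔ a ∈ γ := by
  constructor
  · intro h
    rw [← h, mem_colInsert]
    exact Or.inl rfl
  · intro h
    ext y
    rw [mem_colInsert]
    constructor
    · rintro (rfl | h')
      · exact h
      · exact h'.1
    · intro hy
      rcases eq_or_ne y a with h1 | h1
      · exact Or.inl h1
      · exact Or.inr ⟨hy, fun h2 => ⟨a, h, le_rfl, lt_of_le_of_ne h2 h1.symm⟩⟩

/-- In `mem_colInsert` the column occurs only positively: an entry survives when a witness lies in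
the column, and a larger column keeps the witness. -/
theorem colInsert_mono (a : A) {γ δ : Finset A} (h : γ ⊆ δ) : colInsert a γ ⊆ colInsert a δ := by
  intro y
  rw [mem_colInsert, mem_colInsert]
  refine Or.imp_right fun h1 => ⟨h h1.1, fun h2 => ?_⟩
  obtain ⟨z, hz, h3⟩ := h1.2 h2
  exact ⟨z, h hz, h3⟩

theorem foldr_colInsert_mono (w : List A) {γ δ : Finset A} (h : γ ⊆ δ) :
    w.foldr colInsert γ ⊆ w.foldr colInsert δ := by
  induction w with
  | nil => exact h
  | cons a w ih => exact colInsert_mono a ih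

theorem letter_mul_apply (a : A) (x : Styl A) (γ : Finset A) :
    (letter a * x).1 γ = colInsert a (x.1 γ) := rfl

/-- A column is fixed by `a` exactly when it contains `a`. Testing on the empty column is enough,
since `x · ∅ ⊆ x · γ` by monotonicity. -/
theorem letter_mul_eq_iff {a : A} {x : Styl A} : letter a * x = x ↔ a ∈ x.1 ∅ := by
  constructor
  · intro h
    rw [← colInsert_eq_self_iff, ← letter_mul_apply, h]
  · intro h
    refine Subtype.ext (funext fun γ => ?_)
    rw [letter_mul_apply, colInsert_eq_self_iff]
    rw [← mu_rep, mu_apply] at h ⊢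
    exact foldr_colInsert_mono _ (Finset.empty_subset γ) h

theorem mem_eta {a : A} {x : Styl A} : a ∈ eta x ↔ letter a * x = x := by
  rw [letter_mul_eq_iff, eta, firstColumn_nTableau, mu_rep]

/-- Inserting `b` displaces only an entry `≥ b`, so the smaller letter `a` stays in the column. -/
theorem letter_mul_letter_mul_of_lt {a b : A} (hab : a < b) {x : Styl A}
    (h : letter a * x = x) : letter a * (letter b * x) = letter b * x := by
  rw [letter_mul_eq_iff] at h ⊢
  rw [letter_mul_apply, mem_colInsert]
  exact Or.inr ⟨h, fun h' => absurd hab (not_lt.2 h')⟩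

theorem letter_mul_self_mul (a : A) (x : Styl A) :
    letter a * (letter a * x) = letter a * x := by
  rw [letter_mul_eq_iff, letter_mul_apply, mem_colInsert]
  exact Or.inl rfl

theorem thetaWord_mul (u v : FreeMonoid A) : thetaWord (u * v) = thetaWord v * thetaWord u := by
  simp [thetaWord, FreeMonoid.toList_mul]

theorem thetaWord_of (a : A) : thetaWord (FreeMonoid.of a) = FreeMonoid.of (revLetter a) := rfl

theorem thetaWord_thetaWord (u : FreeMonoid A) : thetaWord (thetaWord u) = u := by
  have hrr : (revLetter : A → A) ∘ revLetter = id := funext revLetter_revLetter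
  simp [thetaWord, hrr]

theorem theta_theta (x : Styl A) : theta (theta x) = x := by
  obtain ⟨w, rfl⟩ := cls_surjective x
  rw [theta_cls, theta_cls, thetaWord_thetaWord]

theorem theta_mul_letter (x : Styl A) (a : A) :
    theta (x * letter a) = letter (revLetter a) * theta x := by
  obtain ⟨w, rfl⟩ := cls_surjective x
  rw [letter, ← map_mul, theta_cls, theta_cls, thetaWord_mul, thetaWord_of, map_mul, letter]

theorem mem_thetaCol {a : A} {γ : Finset A} : a ∈ thetaCol γ ↔ revLetter a ∈ γ := by
  rw [thetaCol, Finset.mem_image]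
  constructor
  · rintro ⟨b, hb, rfl⟩
    rwa [revLetter_revLetter]
  · exact fun h => ⟨_, h, revLetter_revLetter a⟩

/-- The column of letters fixing `x` on the right. -/
noncomputable def etaRight (x : Styl A) : Finset A := thetaCol (eta (theta x))

/-- This is `mem_eta` transported by `theta`, which is injective and turns right multiplication by
`a` into left multiplication by `revLetter a`. -/
theorem mem_etaRight {a : A} {x : Styl A} : a ∈ etaRight x ↔ x * letter a = x := by
  rw [etaRight, mem_thetaCol, mem_eta, ← theta_mul_letter]
  exact (Function.LeftInverse.injective theta_theta).eq_iff

end Order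

/-! ### The elements `e γ` and their sum -/

section Algebra

variable {A : Type*} [LinearOrder A] [Fintype A] (K : Type*) [Field K]

/-- The image of a letter in the algebra of the stylic monoid. -/
noncomputable def algLetter (a : A) : MonoidAlgebra K (Styl A) :=
  MonoidAlgebra.of K (Styl A) (letter a)

/-- The increasing product of `1 - a` over the letters of `γ`. -/
noncomputable def incProd (γ : Finset A) : MonoidAlgebra K (Styl A) :=
  ((γ.sort (fun a b => a ≤ b)).map (fun a => 1 - algLetter K a)).prod

/-- The decreasing product of the letters of `γ`. -/
noncomputable def decProd (γ : Finset A) : MonoidAlgebra K (Styl A) :=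
  ((γ.sort (fun a b => a ≥ b)).map (fun a => algLetter K a)).prod

theorem e_eq (γ : Finset A) : e K γ = incProd K γᶜ * decProd K γ := rfl

theorem sort_insert_max {m : A} {s : Finset A} (h : ∀ x ∈ s, x < m) :
    (insert m s).sort (fun a b => a ≤ b) = s.sort (fun a b => a ≤ b) ++ [m] := by
  have hm : m ∉ s := fun hm => lt_irrefl _ (h m hm)
  refine List.Perm.eq_of_pairwise' (r := (· ≤ ·)) (Finset.pairwise_sort _ _) ?_ ?_
  · rw [List.pairwise_append]
    refine ⟨Finset.pairwise_sort _ _, by simp, ?_⟩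
    intro a ha b hb
    rw [List.mem_singleton] at hb
    rw [hb]
    exact (h a ((Finset.mem_sort _).1 ha)).le
  · rw [List.perm_ext_iff_of_nodup (Finset.sort_nodup _ _)]
    · intro a
      simp [or_comm]
    · rw [List.nodup_append]
      refine ⟨Finset.sort_nodup _ _, by simp, ?_⟩
      rintro a ha b hb rfl
      rw [List.mem_singleton] at hb
      exact hm (hb ▸ (Finset.mem_sort _).1 ha)

theorem incProd_insert_max {m : A} {s : Finset A} (h : ∀ x ∈ s, x < m) :
    incProd K (insert m s) = incProd K s * (1 - algLetter K m) := by
  simp [incProd, sort_insert_max h]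

theorem decProd_insert_max {m : A} {s : Finset A} (h : ∀ x ∈ s, x < m) :
    decProd K (insert m s) = algLetter K m * decProd K s := by
  rw [decProd, Finset.sort_insert _ (fun b hb => (h b hb).le)
    (fun hm => lt_irrefl _ (h m hm)), List.map_cons, List.prod_cons, decProd]

/-- Split off the largest letter `m`. With one product increasing and the other decreasing, `m` sits
in the middle: the terms of `γ` and `insert m γ` carry `1 - m` and `m` between the same two factors,
so they add up to the term of `γ` for `s`. -/
theorem sum_incProd_mul_decProd (s : Finset A) :
    ∑ γ ∈ s.powerset, incProd K (s \ γ) * decProd K γ = 1 := by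
  induction s using Finset.induction_on_max with
  | empty => simp [incProd, decProd]
  | insert m s hs ih =>
    have hm : m ∉ s := fun hm => lt_irrefl _ (hs m hm)
    rw [Finset.sum_powerset_insert hm, ← Finset.sum_add_distrib, ← ih]
    refine Finset.sum_congr rfl fun γ hγ => ?_
    rw [Finset.mem_powerset] at hγ
    rw [Finset.insert_sdiff_of_notMem _ (fun h => hm (hγ h)),
      incProd_insert_max K (fun x hx => hs x (Finset.sdiff_subset hx)),
      Finset.insert_sdiff_insert, Finset.sdiff_insert_of_notMem hm,
      decProd_insert_max K (fun x hx => hs x (hγ hx))]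
    noncomm_ring

theorem sum_e : ∑ γ : Finset A, e K γ = 1 := by
  rw [← sum_incProd_mul_decProd K (Finset.univ : Finset A), Finset.powerset_univ]
  refine Finset.sum_congr rfl fun γ _ => ?_
  rw [e_eq, Finset.compl_eq_univ_sdiff]

/-! ### Spans of sets of monoid elements -/

/-- The span of the elements of the monoid satisfying a condition. -/
noncomputable def spanOf (S : Set (Styl A)) : Submodule K (MonoidAlgebra K (Styl A)) :=
  Submodule.span K (MonoidAlgebra.of K (Styl A) '' S)

variable {K}

theorem of_mem_spanOf {S : Set (Styl A)} {x : Styl A} (h : x ∈ S) :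
    MonoidAlgebra.of K (Styl A) x ∈ spanOf K S := Submodule.subset_span ⟨x, h, rfl⟩

theorem spanOf_univ : spanOf K (Set.univ : Set (Styl A)) = ⊤ := by
  rw [eq_top_iff, ← (MonoidAlgebra.basis (Styl A) K).span_eq]
  refine Submodule.span_mono ?_
  rintro _ ⟨x, rfl⟩
  exact ⟨x, trivial, by simp⟩

theorem map_mem_of_mem_spanOf {V : Type*} [AddCommGroup V] [Module K V]
    (f : MonoidAlgebra K (Styl A) →ₗ[K] V) {S : Set (Styl A)} {W : Submodule K V}
    (h : ∀ x ∈ S, f (MonoidAlgebra.of K (Styl A) x) ∈ W)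
    {z : MonoidAlgebra K (Styl A)} (hz : z ∈ spanOf K S) : f z ∈ W := by
  have : spanOf K S ≤ W.comap f := by
    refine Submodule.span_le.2 ?_
    rintro _ ⟨x, hx, rfl⟩
    exact h x hx
  exact this hz

theorem algLetter_mul_mem {a : A} {S T : Set (Styl A)} (h : ∀ x ∈ S, letter a * x ∈ T)
    {z : MonoidAlgebra K (Styl A)} (hz : z ∈ spanOf K S) : algLetter K a * z ∈ spanOf K T := by
  refine map_mem_of_mem_spanOf (LinearMap.mulLeft K (algLetter K a)) (fun x hx => ?_) hz
  rw [LinearMap.mulLeft_apply, algLetter, ← map_mul]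
  exact of_mem_spanOf (h x hx)

theorem mul_algLetter_mem {a : A} {S T : Set (Styl A)} (h : ∀ x ∈ S, x * letter a ∈ T)
    {z : MonoidAlgebra K (Styl A)} (hz : z ∈ spanOf K S) : z * algLetter K a ∈ spanOf K T := by
  refine map_mem_of_mem_spanOf (LinearMap.mulRight K (algLetter K a)) (fun x hx => ?_) hz
  rw [LinearMap.mulRight_apply, algLetter, ← map_mul]
  exact of_mem_spanOf (h x hx)

/-! ### Action of the two products on monoid elements -/

theorem decProd_eq_of (γ : Finset A) : decProd K γ = MonoidAlgebra.of K (Styl A)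
    ((γ.sort (fun a b => a ≥ b)).map letter).prod := by
  rw [map_list_prod, List.map_map]
  rfl

/-- The factor `a` makes the product starting there fixed by `a`, and the factors to its left are
larger, so they preserve this. -/
theorem letter_mul_prod_decreasing {l : List A} (hl : l.Pairwise (· > ·)) {a : A} (ha : a ∈ l)
    (x : Styl A) : letter a * ((l.map letter).prod * x) = (l.map letter).prod * x := by
  induction l with
  | nil => simp at ha
  | cons b l ih =>
    rw [List.pairwise_cons] at hl
    rw [List.map_cons, List.prod_cons, mul_assoc]
    rcases List.mem_cons.1 ha with rfl | h
    · exact letter_mul_self_mul _ _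
    · exact letter_mul_letter_mul_of_lt (hl.1 a h) (ih hl.2 h)

theorem prod_mul_eq_self {l : List A} {x : Styl A} (h : ∀ a ∈ l, letter a * x = x) :
    (l.map letter).prod * x = x := by
  induction l with
  | nil => simp
  | cons b l ih =>
    rw [List.map_cons, List.prod_cons, mul_assoc, ih fun a ha => h a (by simp [ha]), h b (by simp)]

theorem mul_prod_eq_self {l : List A} {x : Styl A} (h : ∀ a ∈ l, x * letter a = x) :
    x * (l.map letter).prod = x := by
  induction l with
  | nil => simp
  | cons b l ih =>
    rw [List.map_cons, List.prod_cons, ← mul_assoc, h b (by simp), ih fun a ha => h a (by simp [ha])]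

theorem decProd_mul_of {γ : Finset A} {x : Styl A} (h : ∀ a ∈ γ, letter a * x = x) :
    decProd K γ * MonoidAlgebra.of K (Styl A) x = MonoidAlgebra.of K (Styl A) x := by
  rw [decProd_eq_of, ← map_mul, prod_mul_eq_self fun a ha => h a ((Finset.mem_sort _).1 ha)]

theorem of_mul_decProd {γ : Finset A} {x : Styl A} (h : ∀ a ∈ γ, x * letter a = x) :
    MonoidAlgebra.of K (Styl A) x * decProd K γ = MonoidAlgebra.of K (Styl A) x := by
  rw [decProd_eq_of, ← map_mul, mul_prod_eq_self fun a ha => h a ((Finset.mem_sort _).1 ha)]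

theorem decProd_mul_mem (γ : Finset A) (z : MonoidAlgebra K (Styl A)) :
    decProd K γ * z ∈ spanOf K {x | γ ⊆ eta x} := by
  have hz : z ∈ spanOf K Set.univ := by rw [spanOf_univ]; trivial
  refine map_mem_of_mem_spanOf (LinearMap.mulLeft K (decProd K γ)) (fun x _ => ?_) hz
  rw [LinearMap.mulLeft_apply, decProd_eq_of, ← map_mul]
  refine of_mem_spanOf fun a ha => mem_eta.2 (letter_mul_prod_decreasing ?_ ?_ _)
  · exact (Finset.sortedGT_sort γ).pairwise
  · exact (Finset.mem_sort _).2 ha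

/-- The factors to the right of `1 - a` involve only letters larger than `a`. They act first and
keep everything fixed by `a`, so `1 - a` then annihilates the result. -/
theorem incProd_mul_eq_zero {γ : Finset A} {x : Styl A} {a : A} (ha : a ∈ γ)
    (hx : letter a * x = x) : incProd K γ * MonoidAlgebra.of K (Styl A) x = 0 := by
  obtain ⟨l₁, l₂, hl⟩ := List.append_of_mem ((Finset.mem_sort (fun a b => a ≤ b)).2 ha)
  have hlt : ∀ b ∈ l₂, a < b := by
    have := (Finset.sortedLT_sort γ).pairwise
    rw [hl, List.pairwise_append, List.pairwise_cons] at this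
    exact this.2.1.1
  have hmem : (l₂.map (fun a => 1 - algLetter K a)).prod * MonoidAlgebra.of K (Styl A) x ∈
      spanOf K {y | letter a * y = y} := by
    clear hl
    induction l₂ with
    | nil => simpa using of_mem_spanOf (K := K) (S := {y | letter a * y = y}) hx
    | cons b l ih =>
      have h1 := ih fun c hc => hlt c (by simp [hc])
      rw [List.map_cons, List.prod_cons, mul_assoc, sub_mul, one_mul]
      exact sub_mem h1 (algLetter_mul_mem
        (fun y hy => letter_mul_letter_mul_of_lt (hlt b (by simp)) hy) h1)
  have hzero := map_mem_of_mem_spanOf (LinearMap.mulLeft K (1 - algLetter K a)) (W := ⊥)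
    (fun y hy => by
      rw [Submodule.mem_bot, LinearMap.mulLeft_apply, sub_mul, one_mul, algLetter, ← map_mul,
        show letter a * y = y from hy, sub_self]) hmem
  rw [Submodule.mem_bot, LinearMap.mulLeft_apply] at hzero
  rw [incProd, hl, List.map_append, List.map_cons, List.prod_append, List.prod_cons, mul_assoc,
    mul_assoc, hzero, mul_zero]

/-! ### Triangularity with respect to the size of the ideal -/

/-- The span of the elements generating an ideal with less than `n` elements. -/
noncomputable abbrev lowerSpan (A : Type*) [LinearOrder A] [Fintype A] (K : Type*) [Field K] (n : ℕ) :
    Submodule K (MonoidAlgebra K (Styl A)) := spanOf K {x : Styl A | idealCard x < n}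

theorem algLetter_mul_mem_lowerSpan {n : ℕ} (a : A) {z : MonoidAlgebra K (Styl A)}
    (hz : z ∈ lowerSpan A K n) : algLetter K a * z ∈ lowerSpan A K n :=
  algLetter_mul_mem (fun x (hx : idealCard x < n) => show idealCard (letter a * x) < n from
    (by simpa using idealCard_le x (letter a) 1 : idealCard (letter a * x) ≤ _).trans_lt hx) hz

theorem mul_algLetter_mem_lowerSpan {n : ℕ} (a : A) {z : MonoidAlgebra K (Styl A)}
    (hz : z ∈ lowerSpan A K n) : z * algLetter K a ∈ lowerSpan A K n :=
  mul_algLetter_mem (fun x (hx : idealCard x < n) => show idealCard (x * letter a) < n from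
    (by simpa using idealCard_le x 1 (letter a) : idealCard (x * letter a) ≤ _).trans_lt hx) hz

theorem mul_prod_mem_lowerSpan {n : ℕ} (l : List A) {z : MonoidAlgebra K (Styl A)}
    (hz : z ∈ lowerSpan A K n) :
    z * (l.map (fun a => 1 - algLetter K a)).prod ∈ lowerSpan A K n := by
  induction l generalizing z with
  | nil => simpa using hz
  | cons a l ih =>
    rw [List.map_cons, List.prod_cons, ← mul_assoc, mul_sub, mul_one]
    exact ih (sub_mem hz (mul_algLetter_mem_lowerSpan a hz))

theorem mul_decProd_mem_lowerSpan {n : ℕ} (γ : Finset A) {z : MonoidAlgebra K (Styl A)}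
    (hz : z ∈ lowerSpan A K n) : z * decProd K γ ∈ lowerSpan A K n := by
  rw [decProd]
  generalize γ.sort (fun a b => a ≥ b) = l
  induction l generalizing z with
  | nil => simpa using hz
  | cons a l ih =>
    rw [List.map_cons, List.prod_cons, ← mul_assoc]
    exact ih (mul_algLetter_mem_lowerSpan a hz)

theorem incProd_mul_sub_mem {γ : Finset A} {x : Styl A} (h : ∀ a ∈ γ, letter a * x ≠ x) :
    incProd K γ * MonoidAlgebra.of K (Styl A) x - MonoidAlgebra.of K (Styl A) x ∈
      lowerSpan A K (idealCard x) := by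
  have h' : ∀ a ∈ γ.sort (fun a b => a ≤ b), letter a * x ≠ x :=
    fun a ha => h a ((Finset.mem_sort _).1 ha)
  rw [incProd]
  generalize γ.sort (fun a b => a ≤ b) = l at h'
  induction l with
  | nil => simp
  | cons a l ih =>
    have h1 := ih fun b hb => h' b (by simp [hb])
    have h2 : algLetter K a * MonoidAlgebra.of K (Styl A) x ∈ lowerSpan A K (idealCard x) := by
      rw [algLetter, ← map_mul]
      refine of_mem_spanOf ?_
      have := idealCard_lt (x := x) (u := letter a) (v := 1) (by simpa using h' a (by simp))
      simpa using this
    rw [List.map_cons, List.prod_cons]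
    -- With `P` the remaining product, `(1 - a) P x - x = (P x - x) - a (P x - x) - a x`.
    convert sub_mem (sub_mem h1 (algLetter_mul_mem_lowerSpan a h1)) h2 using 1
    noncomm_ring

theorem mul_incProd_sub_mem {γ : Finset A} {x : Styl A} (h : ∀ a ∈ γ, x * letter a ≠ x) :
    MonoidAlgebra.of K (Styl A) x * incProd K γ - MonoidAlgebra.of K (Styl A) x ∈
      lowerSpan A K (idealCard x) := by
  have h' : ∀ a ∈ γ.sort (fun a b => a ≤ b), x * letter a ≠ x :=
    fun a ha => h a ((Finset.mem_sort _).1 ha)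
  rw [incProd]
  generalize γ.sort (fun a b => a ≤ b) = l at h'
  induction l with
  | nil => simp
  | cons a l ih =>
    have h1 := ih fun b hb => h' b (by simp [hb])
    have h2 : MonoidAlgebra.of K (Styl A) x * algLetter K a ∈ lowerSpan A K (idealCard x) := by
      rw [algLetter, ← map_mul]
      refine of_mem_spanOf ?_
      have := idealCard_lt (x := x) (u := 1) (v := letter a) (by simpa using h' a (by simp))
      simpa using this
    rw [List.map_cons, List.prod_cons]
    -- With `Q` the remaining product, `x (1 - a) Q - x = (x Q - x) - (x a) Q`.
    convert sub_mem h1 (mul_prod_mem_lowerSpan l h2) using 1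
    noncomm_ring

theorem e_eta_mul_of (x : Styl A) :
    e K (eta x) * MonoidAlgebra.of K (Styl A) x =
      incProd K (eta x)ᶜ * MonoidAlgebra.of K (Styl A) x := by
  rw [e_eq, mul_assoc, decProd_mul_of fun a ha => mem_eta.1 ha]

theorem e_eta_mul_of_sub_mem (x : Styl A) :
    e K (eta x) * MonoidAlgebra.of K (Styl A) x - MonoidAlgebra.of K (Styl A) x ∈
      lowerSpan A K (idealCard x) := by
  rw [e_eta_mul_of]
  exact incProd_mul_sub_mem fun a ha h => Finset.mem_compl.1 ha (mem_eta.2 h)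

theorem e_mul_of_mul_e_sub_mem (x : Styl A) :
    e K (eta x) * MonoidAlgebra.of K (Styl A) x * e K (etaRight x) -
      MonoidAlgebra.of K (Styl A) x ∈ lowerSpan A K (idealCard x) := by
  have h1 := mul_decProd_mem_lowerSpan (etaRight x) (mul_prod_mem_lowerSpan
    ((etaRight x)ᶜ.sort (fun a b => a ≤ b)) (e_eta_mul_of_sub_mem (K := K) x))
  have h2 := mul_decProd_mem_lowerSpan (etaRight x) (mul_incProd_sub_mem (K := K)
    (γ := (etaRight x)ᶜ) (x := x) fun a ha h => Finset.mem_compl.1 ha (mem_etaRight.2 h))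
  rw [sub_mul, of_mul_decProd fun a ha => mem_etaRight.1 ha] at h2
  -- Write `e (etaRight x) = I D`. The two summands are `(e (eta x) x - x) I D` and `(x I - x) D`,
  -- and the latter is `x I D - x` because `D` fixes `x`.
  convert add_mem h1 h2 using 1
  rw [e_eq K (etaRight x), incProd]
  noncomm_ring

/-! ### The adapted bases, and orthogonality of the `e γ` -/

variable (A K) in
/-- The linear map sending an element `x` of the monoid to `e (eta x) * x`. -/
noncomputable def leftPeirceMap : MonoidAlgebra K (Styl A) →ₗ[K] MonoidAlgebra K (Styl A) :=
  (MonoidAlgebra.basis (Styl A) K).constr K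
    fun x => e K (eta x) * MonoidAlgebra.of K (Styl A) x

variable (A K) in
/-- The linear map sending an element `x` of the monoid to `e (eta x) * x * e (etaRight x)`. -/
noncomputable def peirceMap : MonoidAlgebra K (Styl A) →ₗ[K] MonoidAlgebra K (Styl A) :=
  (MonoidAlgebra.basis (Styl A) K).constr K
    fun x => e K (eta x) * MonoidAlgebra.of K (Styl A) x * e K (etaRight x)

theorem basis_eq_of (x : Styl A) :
    MonoidAlgebra.basis (Styl A) K x = MonoidAlgebra.of K (Styl A) x := by
  simp

theorem leftPeirceMap_of (x : Styl A) :
    leftPeirceMap A K (MonoidAlgebra.of K (Styl A) x) =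
      e K (eta x) * MonoidAlgebra.of K (Styl A) x := by
  rw [← basis_eq_of, leftPeirceMap, Module.Basis.constr_basis, basis_eq_of]

theorem peirceMap_of (x : Styl A) :
    peirceMap A K (MonoidAlgebra.of K (Styl A) x) =
      e K (eta x) * MonoidAlgebra.of K (Styl A) x * e K (etaRight x) := by
  rw [← basis_eq_of, peirceMap, Module.Basis.constr_basis, basis_eq_of]

theorem coe_basis_eq : ⇑(MonoidAlgebra.basis (Styl A) K) = MonoidAlgebra.of K (Styl A) :=
  funext basis_eq_of

theorem leftPeirceMap_injective : Function.Injective (leftPeirceMap A K) := by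
  refine (MonoidAlgebra.basis (Styl A) K).injective_of_unitriangular idealCard _ fun x => ?_
  rw [coe_basis_eq, leftPeirceMap_of]
  exact e_eta_mul_of_sub_mem x

theorem peirceMap_injective : Function.Injective (peirceMap A K) := by
  refine (MonoidAlgebra.basis (Styl A) K).injective_of_unitriangular idealCard _ fun x => ?_
  rw [coe_basis_eq, peirceMap_of]
  exact e_mul_of_mul_e_sub_mem x

theorem peirceMap_surjective : Function.Surjective (peirceMap A K) := by
  have : Module.Finite K (MonoidAlgebra K (Styl A)) :=
    Module.Finite.of_basis (MonoidAlgebra.basis (Styl A) K)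
  exact LinearMap.injective_iff_surjective.1 peirceMap_injective

/-- The decreasing product pushes `z` into the span of the `x` with `γ ⊆ eta x`. The increasing
product kills those with strict inclusion, and on the rest it acts as `e (eta x)`. -/
theorem exists_leftPeirceMap_eq (γ : Finset A) (z : MonoidAlgebra K (Styl A)) :
    ∃ y ∈ spanOf K {x : Styl A | eta x = γ}, leftPeirceMap A K y = e K γ * z := by
  rw [e_eq, mul_assoc]
  refine map_mem_of_mem_spanOf (LinearMap.mulLeft K (incProd K γᶜ))
    (W := (spanOf K {x : Styl A | eta x = γ}).map (leftPeirceMap A K)) (fun x hx => ?_)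
    (decProd_mul_mem γ z)
  rw [LinearMap.mulLeft_apply]
  by_cases h : eta x = γ
  · refine ⟨_, of_mem_spanOf h, ?_⟩
    rw [leftPeirceMap_of, e_eta_mul_of, h]
  · obtain ⟨a, ha, ha'⟩ := Finset.exists_of_ssubset (lt_of_le_of_ne hx (Ne.symm h))
    rw [incProd_mul_eq_zero (Finset.mem_compl.2 ha') (mem_eta.1 ha)]
    exact zero_mem _

theorem mem_spanOf_iff {S : Set (Styl A)} {z : MonoidAlgebra K (Styl A)} :
    z ∈ spanOf K S ↔ ∀ x ∉ S, (MonoidAlgebra.basis (Styl A) K).repr z x = 0 := by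
  rw [spanOf, ← coe_basis_eq, Module.Basis.mem_span_image]
  simp only [Set.subset_def, Finset.mem_coe, Finsupp.mem_support_iff]
  exact forall_congr' fun x => not_imp_comm

/-- The sum of the right ideals generated by the `e γ` is direct. -/
theorem e_mul_eq_zero_of_sum_eq_zero (z : Finset A → MonoidAlgebra K (Styl A))
    (h : ∑ γ, e K γ * z γ = 0) (γ : Finset A) : e K γ * z γ = 0 := by
  choose y hy hyz using fun γ => exists_leftPeirceMap_eq γ (z γ)
  have h1 : ∑ γ, y γ = 0 := by
    apply leftPeirceMap_injective
    rw [map_sum, map_zero, ← h]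
    exact Finset.sum_congr rfl fun γ _ => hyz γ
  -- The `y δ` are supported on disjoint sets of monoid elements, so the coefficient of `x` in their
  -- sum comes from `y (eta x)` alone.
  have h2 : y γ = 0 := by
    apply (MonoidAlgebra.basis (Styl A) K).repr.injective
    ext x
    by_cases hx : eta x = γ
    · have h3 := congrArg (fun z => (MonoidAlgebra.basis (Styl A) K).repr z x) h1
      simp only [map_sum, Finsupp.coe_finsetSum, Finset.sum_apply] at h3
      rw [Finset.sum_eq_single γ] at h3
      · simpa using h3
      · exact fun δ _ hδ => mem_spanOf_iff.1 (hy δ) x fun h => hδ (h.symm.trans hx)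
      · simp
    · simpa using mem_spanOf_iff.1 (hy γ) x hx
  rw [← hyz, h2, map_zero]

/-- As the `e γ` sum to 1, `e δ` equals `∑ γ, e γ * e δ`. It also has the trivial expression `e δ *
1`, and directness lets the components of the two be compared. -/
theorem e_mul_e (γ δ : Finset A) : e K γ * e K δ = if γ = δ then e K γ else 0 := by
  have h := e_mul_eq_zero_of_sum_eq_zero (K := K) (fun γ => e K δ - if γ = δ then 1 else 0)
    (by simp [mul_sub, Finset.sum_sub_distrib, ← Finset.sum_mul, sum_e]) γ
  rw [mul_sub, sub_eq_zero] at h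
  simp [h]

/-! ### Peirce spaces and their dimension -/

theorem mem_peirce {L : Type*} [Ring L] [Algebra K L] {a b z : L} :
    z ∈ peirce K a b ↔ ∃ y, a * y * b = z := by
  simp [peirce, LinearMap.mulLeftRight_apply]

theorem peirce_e_eq_map (γ γ' : Finset A) : peirce K (e K γ) (e K γ') =
    (spanOf K {x : Styl A | eta x = γ ∧ etaRight x = γ'}).map (peirceMap A K) := by
  apply le_antisymm
  · intro z hz
    obtain ⟨y, rfl⟩ := mem_peirce.1 hz
    -- Surjectivity lets the middle factor be taken in the adapted basis, where orthogonality on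
    -- both sides either fixes or kills each term.
    obtain ⟨u, rfl⟩ := peirceMap_surjective y
    have hu : u ∈ spanOf K Set.univ := by rw [spanOf_univ]; trivial
    refine map_mem_of_mem_spanOf
      (LinearMap.mulLeftRight K (e K γ, e K γ') ∘ₗ peirceMap A K) (fun x _ => ?_) hu
    rw [LinearMap.comp_apply, peirceMap_of, LinearMap.mulLeftRight_apply]
    have h1 : e K γ * (e K (eta x) * MonoidAlgebra.of K (Styl A) x * e K (etaRight x)) * e K γ' =
        e K γ * e K (eta x) * MonoidAlgebra.of K (Styl A) x * (e K (etaRight x) * e K γ') := by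
      simp only [mul_assoc]
    rw [h1, e_mul_e, e_mul_e]
    by_cases hl : γ = eta x
    · by_cases hr : etaRight x = γ'
      · rw [if_pos hl, if_pos hr]
        refine ⟨_, of_mem_spanOf ⟨hl.symm, hr⟩, ?_⟩
        rw [peirceMap_of, hl]
      · rw [if_neg hr, mul_zero]
        exact zero_mem _
    · rw [if_neg hl, zero_mul, zero_mul]
      exact zero_mem _
  · rintro _ ⟨u, hu, rfl⟩
    refine map_mem_of_mem_spanOf (peirceMap A K) ?_ hu
    rintro x ⟨rfl, rfl⟩
    rw [peirceMap_of]
    exact mem_peirce.2 ⟨_, rfl⟩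

theorem finrank_spanOf (S : Set (Styl A)) : Module.finrank K (spanOf K S) = S.ncard := by
  have hli := (MonoidAlgebra.basis (Styl A) K).linearIndependent
  rw [coe_basis_eq] at hli
  have := Fintype.ofFinite S
  rw [spanOf, Set.image_eq_range]
  exact (finrank_span_eq_card (hli.comp _ Subtype.val_injective)).trans (by
    rw [← Nat.card_eq_fintype_card, Nat.card_coe_set_eq])

end Algebra

end Stylic

theorem proposition4 (A : Type*) [LinearOrder A] [Fintype A] (K : Type*) [Field K]
    (γ γ' : Finset A) :
    Module.finrank K (Stylic.peirce K (Stylic.e K γ) (Stylic.e K γ')) =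
      Set.ncard {x : Stylic.Styl A |
        Stylic.eta x = γ ∧ Stylic.thetaCol (Stylic.eta (Stylic.theta x)) = γ'} := by
  rw [Stylic.peirce_e_eq_map, ← (Submodule.equivMapOfInjective (Stylic.peirceMap A K)
    Stylic.peirceMap_injective _).finrank_eq, Stylic.finrank_spanOf]
  -- `etaRight x` is by definition `thetaCol (eta (theta x))`.
  rfl
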